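/- Let $N\ge 1$ and $\Lambda=\{1,\dots,N\}$. For each $i\in\Lambda$ let $n_i>m_i\ge 2$ be integers, divide the unit square $[0,1]^2$ into a uniform $m_i\times n_i$ grid ($m_i$ columns, $n_i$ rows), and choose a non-empty set $D_i\subseteq\{0,\dots,m_i-1\}\times\{0,\dots,n_i-1\}$ of cells. For $(a,b)\in D_i$ let $S_{i,(a,b)}(x,y)=\big(\tfrac{x+a}{m_i},\tfrac{y+b}{n_i}\big)$. Let $A_i$ be the number of distinct first coordinates of elements of $D_i$ (the number of non-empty columns), and let $B_i=\max_{a}|\{b:(a,b)\in D_i\}|$ (the maximal number of chosen cells in a column). For $\omega=(\omega_1,\omega_2,\dots)\in\Omega=\Lambda^{\mathbb N}$ the random Bedford–McMullen carpet is $$F_\omega=\bigcap_{k}\ \bigcup_{j_1\in D_{\omega_1},\dots,j_k\in D_{\omega_k}} S_{\omega_1,j_1}\circ\dots\circ S_{\omega_k,j_k}\big([0,1]^2\big).$$ Let $(p_i)_{i\in\Lambda}$ be a probability vector with $p_i>0$ for all $i$, and let $\mu$ be the corresponding Bernoulli (infinite product) measure on $\Omega$. The Assouad dimension $\dim_{\mathrm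 A}F$ of a non-empty set $F$ in a metric space is the infimum of all $\alpha$ for which there are $C,\rho>0$ such that $N_r(B(x,R)\cap F)\le C(R/r)^\alpha$ for all $0<r<R\le\rho$ and all $x\in F$, where $N_r(E)$ is the smallest number of sets of diameter at most $r$ needed to cover $E$. **Theorem.** For $\mu$-almost every $\omega\in\Omega$, $$\dim_{\mathrm A}F_\omega=\max_{i\in\Lambda}\frac{\log A_i}{\log m_i}+\max_{i\in\Lambda}\frac{\log B_i}{\log n_i}.$$ This can exceed every deterministic value: there is a choice of two patterns $(m_i,n_i,D_i)$, $i\in\{1,2\}$, such that, for every probability vector $(p_1,p_2)$ with $p_1,p_2>0$, almost surely $\dim_{\mathrm A}F_\omega>\dim_{\mathrm A}F_{(i,i,i,\dots)}$ for both $i=1,2$. -/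

import Mathlib

open MeasureTheory

noncomputable section

namespace RandomCarpet

/-- `N_r(E)`: the smallest number of sets of diameter at most `r` needed to cover `E`
(`⊤` if no finite number of such sets suffices). -/
def coverNumber {X : Type*} [MetricSpace X] (r : ℝ) (E : Set X) : ℕ∞ :=
  ⨅ (U : Set (Set X)) (_ : (∀ V ∈ U, Metric.ediam V ≤ ENNReal.ofReal r) ∧ E ⊆ ⋃₀ U), U.encard

/-- The exponent `α` is admissible for `F`: there are constants `C, ρ > 0` such that
`N_r(B(x, R) ∩ F) ≤ C (R / r) ^ α` for all `0 < r < R ≤ ρ` and all `x ∈ F`. -/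
def AssouadAdmissible {X : Type*} [MetricSpace X] (F : Set X) (α : ℝ) : Prop :=
  ∃ C > (0 : ℝ), ∃ ρ > (0 : ℝ), ∀ r R : ℝ, 0 < r → r < R → R ≤ ρ →
    ∀ x ∈ F, (coverNumber r (Metric.closedBall x R ∩ F) : ENNReal) ≤
      ENNReal.ofReal (C * (R / r) ^ α)

/-- The Assouad dimension of a non-empty set `F`: the infimum of the admissible exponents,
taken in the extended reals, so that it is `⊤` if there are none. -/
def assouadDim {X : Type*} [MetricSpace X] (F : Set X) : EReal :=
  sInf ((fun α : ℝ => (α : EReal)) '' {α : ℝ | AssouadAdmissible F α})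

/-- The composition `S_{ω₁, j₁} ∘ ⋯ ∘ S_{ω_k, j_k}` (indices are shifted by one: `ω` and `j`
start at `0`). -/
def wordMap {X Λ : Type*} {I : Λ → Type*} (S : (i : Λ) → I i → X → X) (ω : ℕ → Λ) :
    (k : ℕ) → ((l : Fin k) → I (ω l)) → X → X
  | 0, _ => id
  | k + 1, j => wordMap S ω k (fun l => j l.castSucc) ∘ S (ω k) (j (Fin.last k))

/-- The attractor `F_ω = ⋂_k ⋃_{j₁, …, j_k} S_{ω₁, j₁} ∘ ⋯ ∘ S_{ω_k, j_k} (K)` of a random iterated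
function system acting on the compact set `K`. -/
def attractor {X Λ : Type*} {I : Λ → Type*} (S : (i : Λ) → I i → X → X) (K : Set X)
    (ω : ℕ → Λ) : Set X :=
  ⋂ k : ℕ, ⋃ j : (l : Fin k) → I (ω l), wordMap S ω k j '' K

/-- A Bedford–McMullen pattern: a non-empty set of chosen cells `(a, b)` (column `a`, row `b`) of
the uniform `m × n` grid on the unit square, where `n > m ≥ 2`. -/
structure Pattern where
  m : ℕ
  n : ℕ
  two_le_m : 2 ≤ m
  m_lt_n : m < n
  cells : Finset (Fin m × Fin n)
  cells_nonempty : cells.Nonempty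

/-- The number of non-empty columns of the pattern. -/
def Pattern.A (P : Pattern) : ℕ := (P.cells.image Prod.fst).card

/-- The maximal number of chosen cells in a column of the pattern. -/
def Pattern.B (P : Pattern) : ℕ :=
  Finset.univ.sup fun a : Fin P.m => (P.cells.filter fun c => c.1 = a).card

/-- The affine map taking the unit square onto the cell `c = (a, b)`:
`(x, y) ↦ (x / m + a / m, y / n + b / n)`. -/
def Pattern.map (P : Pattern) (c : P.cells) (z : EuclideanSpace ℝ (Fin 2)) :
    EuclideanSpace ℝ (Fin 2) :=
  !₂[z 0 / P.m + (c.1.1 : ℕ) / P.m, z 1 / P.n + (c.1.2 : ℕ) / P.n]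

/-- The unit square `[0, 1]²` in the Euclidean plane. -/
def unitSquare : Set (EuclideanSpace ℝ (Fin 2)) := {z | ∀ t, z t ∈ Set.Icc (0 : ℝ) 1}

/-- The random Bedford–McMullen carpet `F_ω` of the patterns `P 0, …, P (N - 1)`. -/
def carpet {N : ℕ} (P : Fin N → Pattern) (ω : ℕ → Fin N) : Set (EuclideanSpace ℝ (Fin 2)) :=
  attractor (fun i => (P i).map) unitSquare ω

/-- The Bernoulli measure on `Ω = {0, …, N - 1}^ℕ` with probability vector `p`: the infinite product
of copies of `p`. -/
def bernoulliMeasure {N : ℕ} (p : PMF (Fin N)) : Measure (ℕ → Fin N) :=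
  Measure.infinitePi fun _ => p.toMeasure

end RandomCarpet

end

open MeasureTheory

noncomputable section

namespace RandomCarpet

/-! Write M_k and N_k for the products of the first k column and row radices. A piece of the carpet
of size R is described by column digits up to K and row digits up to k, where M_K and N_k are
comparable to 1/R; since m < n, k ≤ K. Refining it to size r means choosing the column digits in a
window after K and the row digits in a window after k. A letter i offers at most A_i columns and,
once the column is known, at most B_i rows. As A_i ≤ m_i^α and B_i ≤ n_i^β for the maximal exponents
α and β, the number of choices is at most a constant times (R/r)^(α+β). This bound holds for every ω
(`assouadAdmissible_digitCarpet`).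

For the lower bound, N_k / M_k tends to infinity, so for large k the two windows are disjoint and
the letters in them are independent. Almost surely, at arbitrarily small scales, the row window is
filled with a letter j maximising log B / log n and the column window with a letter i maximising log
A / log m (`ae_hasLongRuns`). All choices are then available at once, and the exponent α + β is
forced (`le_of_assouadAdmissible`). A constant sequence has to use the same letter in both windows,
which is why mixing two patterns can increase the dimension.

The start K of the column window depends on ω. It is a stopping time (`passage`), so the strong
Markov property gives the probability of a double run, and successive trials at well separated
levels fail with geometrically decaying probability. -/

/-! ### Mixed radix expansions -/

/-- The product of the first `k` radices. -/
def scale (q : ℕ → ℕ) (k : ℕ) : ℕ := ∏ l ∈ Finset.range k, q l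

/-- The integer whose mixed radix digits are `d 0, …, d (k - 1)`, most significant digit first. -/
def digitSum (q d : ℕ → ℕ) : ℕ → ℕ
  | 0 => 0
  | k + 1 => digitSum q d k * q k + d k

/-- The interval of numbers in `[0, 1]` whose expansion starts with `d 0, …, d (k - 1)`. -/
def strip (q d : ℕ → ℕ) (k : ℕ) : Set ℝ :=
  Set.Icc ((digitSum q d k : ℝ) / scale q k) ((digitSum q d k + 1 : ℝ) / scale q k)

@[simp] lemma scale_zero (q : ℕ → ℕ) : scale q 0 = 1 := by simp [scale]

lemma scale_succ (q : ℕ → ℕ) (k : ℕ) : scale q (k + 1) = scale q k * q k := by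
  simp [scale, Finset.prod_range_succ]

lemma scale_pos {q : ℕ → ℕ} (hq : ∀ l, 0 < q l) (k : ℕ) : 0 < scale q k :=
  Finset.prod_pos fun l _ => hq l

lemma scale_add (q : ℕ → ℕ) (k s : ℕ) :
    scale q (k + s) = scale q k * ∏ l ∈ Finset.range s, q (k + l) :=
  Finset.prod_range_add _ _ _

lemma scale_mono {q : ℕ → ℕ} (hq : ∀ l, 0 < q l) : Monotone (scale q) :=
  monotone_nat_of_le_succ fun k => by
    rw [scale_succ]; exact Nat.le_mul_of_pos_right _ (hq k)

lemma two_pow_le_scale {q : ℕ → ℕ} (hq : ∀ l, 2 ≤ q l) (k : ℕ) : 2 ^ k ≤ scale q k := by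
  simpa [scale] using Finset.prod_le_prod' (s := Finset.range k) (fun l _ => hq l)

lemma scale_le_pow {q : ℕ → ℕ} {C : ℕ} (hq : ∀ l, q l ≤ C) (k : ℕ) : scale q k ≤ C ^ k := by
  simpa [scale] using Finset.prod_le_prod' (s := Finset.range k) (fun l _ => hq l)

lemma scale_congr {q q' : ℕ → ℕ} {k : ℕ} (h : ∀ l < k, q l = q' l) : scale q k = scale q' k :=
  Finset.prod_congr rfl fun l hl => h l (Finset.mem_range.1 hl)

lemma digitSum_congr (q : ℕ → ℕ) {d d' : ℕ → ℕ} {k : ℕ} (h : ∀ l < k, d l = d' l) :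
    digitSum q d k = digitSum q d' k := by
  induction k with
  | zero => rfl
  | succ k ih =>
    rw [digitSum, digitSum, ih fun l hl => h l (by omega), h k (by omega)]

/-- Reduction modulo the last radix recovers the last digit. In the upper bound this lets the index
of a column strip determine all its column digits, hence the rows allowed there. -/
lemma digit_eq_of_digitSum_eq {q d d' : ℕ → ℕ} (hd : ∀ l, d l < q l) (hd' : ∀ l, d' l < q l)
    {k : ℕ} (h : digitSum q d k = digitSum q d' k) : ∀ l < k, d l = d' l := by
  induction k with
  | zero => simp
  | succ k ih =>
    rw [digitSum, digitSum] at h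
    have h1 : d k = d' k := by
      have := congrArg (· % q k) h
      simpa [Nat.add_mod, Nat.mod_eq_of_lt (hd k), Nat.mod_eq_of_lt (hd' k)] using this
    have h2 : digitSum q d k = digitSum q d' k := by
      rw [h1] at h
      exact Nat.eq_of_mul_eq_mul_right (lt_of_le_of_lt (Nat.zero_le _) (hd k))
        (Nat.add_right_cancel h)
    intro l hl
    rcases Nat.lt_succ_iff_lt_or_eq.1 hl with hl | rfl
    · exact ih h2 l hl
    · exact h1

lemma strip_succ_subset {q d : ℕ → ℕ} (hd : ∀ l, d l < q l) (k : ℕ) :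
    strip q d (k + 1) ⊆ strip q d k := by
  have hq : ∀ l, 0 < q l := fun l => lt_of_le_of_lt (Nat.zero_le _) (hd l)
  have h1 : (0 : ℝ) < scale q k := by exact_mod_cast scale_pos hq k
  have h2 : (0 : ℝ) < q k := by exact_mod_cast hq k
  have h3 : (d k : ℝ) + 1 ≤ q k := by exact_mod_cast hd k
  have h4 : (0 : ℝ) ≤ d k := by positivity
  apply Set.Icc_subset_Icc
  · rw [scale_succ, digitSum, div_le_div_iff₀ h1 (by push_cast; positivity)]
    push_cast
    nlinarith [mul_nonneg h1.le h4]
  · rw [scale_succ, digitSum, div_le_div_iff₀ (by push_cast; positivity) h1]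
    push_cast
    nlinarith [mul_le_mul_of_nonneg_left h3 h1.le]

lemma strip_antitone {q d : ℕ → ℕ} (hd : ∀ l, d l < q l) : Antitone (strip q d) :=
  antitone_nat_of_succ_le (strip_succ_subset hd)

/-- Every sequence of digits is the expansion of some number. -/
lemma exists_mem_strip {q d : ℕ → ℕ} (hd : ∀ l, d l < q l) : ∃ x, ∀ k, x ∈ strip q d k := by
  refine ⟨⨆ k, (digitSum q d k : ℝ) / scale q k, fun k => ?_⟩
  have h := ciSup_mem_iInter_Icc_of_antitone_Icc (strip_antitone hd) (fun k => by gcongr; simp)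
  exact Set.mem_iInter.1 h k

/-- The integers obtained from elements of `S` by appending the digits number `k, …, k + s - 1`,
chosen from the sets `E k, …, E (k + s - 1)`. -/
def extensions (q : ℕ → ℕ) (E : ℕ → Finset ℕ) (k : ℕ) (S : Finset ℕ) : ℕ → Finset ℕ
  | 0 => S
  | s + 1 => (extensions q E k S s ×ˢ E (k + s)).image fun p => p.1 * q (k + s) + p.2

lemma card_extensions_le (q : ℕ → ℕ) (E : ℕ → Finset ℕ) (k : ℕ) (S : Finset ℕ) (s : ℕ) :
    (extensions q E k S s).card ≤ S.card * ∏ l ∈ Finset.range s, (E (k + l)).card := by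
  induction s with
  | zero => simp [extensions]
  | succ s ih =>
    rw [Finset.prod_range_succ, ← mul_assoc]
    refine Finset.card_image_le.trans ?_
    rw [Finset.card_product]
    exact Nat.mul_le_mul_right _ ih

lemma card_extensions {q : ℕ → ℕ} {E : ℕ → Finset ℕ} {k : ℕ} (S : Finset ℕ) (s : ℕ)
    (hE : ∀ l < s, ∀ d ∈ E (k + l), d < q (k + l)) :
    (extensions q E k S s).card = S.card * ∏ l ∈ Finset.range s, (E (k + l)).card := by
  induction s with
  | zero => simp [extensions]
  | succ s ih =>
    rw [Finset.prod_range_succ, ← mul_assoc, ← ih fun l hl => hE l (by omega), extensions,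
      Finset.card_image_of_injOn, Finset.card_product]
    rintro ⟨w, d⟩ hw ⟨w', d'⟩ hw' h
    rw [Finset.mem_coe, Finset.mem_product] at hw hw'
    have hd := hE s (by omega) d hw.2
    have hd' := hE s (by omega) d' hw'.2
    have h1 : d = d' := by
      have := congrArg (· % q (k + s)) h
      simpa [Nat.add_mod, Nat.mod_eq_of_lt hd, Nat.mod_eq_of_lt hd'] using this
    subst h1
    have h2 : w = w' :=
      Nat.eq_of_mul_eq_mul_right (lt_of_le_of_lt (Nat.zero_le _) hd) (Nat.add_right_cancel h)
    rw [h2]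

lemma digitSum_mem_extensions {q d : ℕ → ℕ} {E : ℕ → Finset ℕ} {k : ℕ} {S : Finset ℕ} {s : ℕ}
    (h0 : digitSum q d k ∈ S) (hd : ∀ l < s, d (k + l) ∈ E (k + l)) :
    digitSum q d (k + s) ∈ extensions q E k S s := by
  induction s with
  | zero => exact h0
  | succ s ih =>
    exact Finset.mem_image.2 ⟨(digitSum q d (k + s), d (k + s)),
      Finset.mem_product.2 ⟨ih fun l hl => hd l (by omega), hd s (by omega)⟩, rfl⟩

/-- Agreement with `d` on both sides of the window matters: outside it, the digits still come from
the cells chosen beforehand. -/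
lemma exists_digits_of_mem_extensions {q d : ℕ → ℕ} {E : ℕ → Finset ℕ} {k s u : ℕ}
    (hu : u ∈ extensions q E k {digitSum q d k} s) :
    ∃ d' : ℕ → ℕ, (∀ l, l < k ∨ k + s ≤ l → d' l = d l) ∧ (∀ l < s, d' (k + l) ∈ E (k + l)) ∧
      digitSum q d' (k + s) = u := by
  induction s generalizing u with
  | zero => exact ⟨d, fun _ _ => rfl, by simp, by simpa [extensions, eq_comm] using hu⟩
  | succ s ih =>
    obtain ⟨⟨w, e⟩, hwe, rfl⟩ := Finset.mem_image.1 hu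
    obtain ⟨hw, he⟩ := Finset.mem_product.1 hwe
    obtain ⟨d', h1, h2, h3⟩ := ih hw
    refine ⟨Function.update d' (k + s) e, fun l hl => ?_, fun l hl => ?_, ?_⟩
    · rw [Function.update_of_ne (by omega)]
      exact h1 l (by omega)
    · rcases Nat.lt_succ_iff_lt_or_eq.1 hl with hl | rfl
      · rw [Function.update_of_ne (by omega)]
        exact h2 l hl
      · simpa using he
    · rw [← add_assoc, digitSum, ← h3]
      congr 1
      · congr 1
        exact digitSum_congr q fun l hl => Function.update_of_ne (by omega) _ _
      · simp

/-- The first level at which the scale reaches `T`. -/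
lemma exists_level {q : ℕ → ℕ} {C : ℕ} (h2 : ∀ l, 2 ≤ q l) (hC : ∀ l, q l ≤ C) {T : ℝ}
    (hT : 1 ≤ T) : ∃ k, T ≤ scale q k ∧ (scale q k : ℝ) ≤ C * T ∧ ∀ j < k, (scale q j : ℝ) < T := by
  classical
  have hex : ∃ k, T ≤ scale q k := by
    obtain ⟨k, hk⟩ := pow_unbounded_of_one_lt T (one_lt_two)
    exact ⟨k, hk.le.trans (by exact_mod_cast two_pow_le_scale h2 k)⟩
  have hmin : ∀ j < Nat.find hex, (scale q j : ℝ) < T := fun j hj => not_le.1 (Nat.find_min hex hj)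
  refine ⟨Nat.find hex, Nat.find_spec hex, ?_, hmin⟩
  have hC1 : (1 : ℝ) ≤ C := by exact_mod_cast (by have := h2 0; have := hC 0; omega : 1 ≤ C)
  rcases h : Nat.find hex with _ | k
  · simp only [scale_zero, Nat.cast_one]; nlinarith
  · rw [scale_succ]
    push_cast
    have h1 := (hmin k (by omega)).le
    have h3 : (q k : ℝ) ≤ C := by exact_mod_cast hC k
    rw [mul_comm]
    exact mul_le_mul h3 h1 (by positivity) (by positivity)

/-! ### Digit description of the carpets -/

/-- The cells of a pattern, as pairs of natural numbers. -/
def Pattern.natCells (P : Pattern) : Finset (ℕ × ℕ) :=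
  P.cells.image fun c => ((c.1 : ℕ), (c.2 : ℕ))

lemma Pattern.lt_of_mem_natCells {P : Pattern} {c : ℕ × ℕ} (h : c ∈ P.natCells) :
    c.1 < P.m ∧ c.2 < P.n := by
  obtain ⟨c, -, rfl⟩ := Finset.mem_image.1 h
  exact ⟨c.1.2, c.2.2⟩

lemma Pattern.natCells_nonempty (P : Pattern) : P.natCells.Nonempty := P.cells_nonempty.image _

/-- The chosen rows in the column `a`. -/
def Pattern.rows (P : Pattern) (a : ℕ) : Finset ℕ :=
  (P.natCells.filter fun c => c.1 = a).image Prod.snd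

lemma Pattern.mem_rows {P : Pattern} {a b : ℕ} : b ∈ P.rows a ↔ (a, b) ∈ P.natCells := by
  simp [Pattern.rows]

lemma Pattern.card_columns (P : Pattern) : (P.natCells.image Prod.fst).card = P.A := by
  rw [Pattern.natCells, Finset.image_image, Pattern.A,
    ← Finset.card_image_of_injective (P.cells.image Prod.fst) Fin.val_injective,
    Finset.image_image]
  rfl

lemma Pattern.card_rows (P : Pattern) (a : Fin P.m) :
    (P.rows a).card = (P.cells.filter fun c => c.1 = a).card := by
  have : P.rows a = (P.cells.filter fun c => c.1 = a).image fun c => (c.2 : ℕ) := by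
    ext b
    simp only [Pattern.mem_rows, Pattern.natCells, Finset.mem_image, Finset.mem_filter,
      Prod.mk.injEq]
    constructor
    · rintro ⟨c, hc, h1, h2⟩
      exact ⟨c, ⟨hc, Fin.ext h1⟩, h2⟩
    · rintro ⟨c, ⟨hc, h1⟩, h2⟩
      exact ⟨c, hc, by rw [h1], h2⟩
  rw [this, Finset.card_image_of_injOn]
  rintro ⟨c1, c2⟩ hc ⟨d1, d2⟩ hd h
  simp only [Finset.coe_filter, Set.mem_ofPred_eq] at hc hd
  rw [Prod.mk.injEq]
  exact ⟨hc.2.trans hd.2.symm, Fin.ext h⟩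

lemma Pattern.card_rows_le (P : Pattern) (a : ℕ) : (P.rows a).card ≤ P.B := by
  by_cases h : a < P.m
  · rw [P.card_rows ⟨a, h⟩]
    exact Finset.le_sup (f := fun a : Fin P.m => (P.cells.filter fun c => c.1 = a).card)
      (Finset.mem_univ (⟨a, h⟩ : Fin P.m))
  · have : P.rows a = ∅ := Finset.eq_empty_of_forall_notMem fun b hb =>
      h (Pattern.lt_of_mem_natCells (Pattern.mem_rows.1 hb)).1
    simp [this]

lemma Pattern.exists_card_rows (P : Pattern) : ∃ a, (P.rows a).card = P.B := by
  have : NeZero P.m := ⟨by have := P.two_le_m; omega⟩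
  obtain ⟨a, -, ha⟩ := Finset.exists_mem_eq_sup (Finset.univ : Finset (Fin P.m))
    Finset.univ_nonempty fun a : Fin P.m => (P.cells.filter fun c => c.1 = a).card
  exact ⟨a, (P.card_rows a).trans ha.symm⟩

lemma Pattern.one_le_A (P : Pattern) : 1 ≤ P.A :=
  Finset.card_pos.2 (P.cells_nonempty.image _)

lemma Pattern.one_le_B (P : Pattern) : 1 ≤ P.B := by
  obtain ⟨⟨a, b⟩, hc⟩ := P.natCells_nonempty
  exact (Finset.card_pos.2 ⟨b, Pattern.mem_rows.2 hc⟩).trans_le (P.card_rows_le a)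

/-- The carpet of a sequence of patterns, in terms of digit expansions. -/
def digitCarpet (Q : ℕ → Pattern) : Set (EuclideanSpace ℝ (Fin 2)) :=
  {z | ∀ k, ∃ a b : ℕ → ℕ, (∀ l, (a l, b l) ∈ (Q l).natCells) ∧
    z 0 ∈ strip (fun l => (Q l).m) a k ∧ z 1 ∈ strip (fun l => (Q l).n) b k}

/-- The innermost map contributes the last, least significant digit, so the translations accumulate
as a mixed radix numerator. -/
lemma wordMap_apply {N : ℕ} (P : Fin N → Pattern) (ω : ℕ → Fin N) (k : ℕ)
    (j : (l : Fin k) → (P (ω l)).cells) (a b : ℕ → ℕ)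
    (ha : ∀ l : Fin k, a l = (j l).1.1) (hb : ∀ l : Fin k, b l = (j l).1.2)
    (z : EuclideanSpace ℝ (Fin 2)) :
    wordMap (fun i => (P i).map) ω k j z =
      !₂[(digitSum (fun l => (P (ω l)).m) a k + z 0) / scale (fun l => (P (ω l)).m) k,
        (digitSum (fun l => (P (ω l)).n) b k + z 1) / scale (fun l => (P (ω l)).n) k] := by
  induction k generalizing z with
  | zero =>
    ext t
    fin_cases t <;> simp [wordMap, digitSum]
  | succ k ih =>
    rw [wordMap, Function.comp_apply, ih _ (fun l => ha l.castSucc) (fun l => hb l.castSucc)]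
    have h1 := ha (Fin.last k)
    have h2 := hb (Fin.last k)
    simp only [Fin.val_last] at h1 h2
    have hm : ((P (ω k)).m : ℝ) ≠ 0 := by
      have := (P (ω k)).two_le_m
      exact_mod_cast (by omega : (P (ω k)).m ≠ 0)
    have hn : ((P (ω k)).n : ℝ) ≠ 0 := by
      have := (P (ω k)).two_le_m
      have := (P (ω k)).m_lt_n
      exact_mod_cast (by omega : (P (ω k)).n ≠ 0)
    have hM : (scale (fun l => (P (ω l)).m) k : ℝ) ≠ 0 := by
      exact_mod_cast (scale_pos (fun l => by have := (P (ω l)).two_le_m; omega) k).ne'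
    have hN : (scale (fun l => (P (ω l)).n) k : ℝ) ≠ 0 := by
      exact_mod_cast (scale_pos
        (fun l => by have := (P (ω l)).two_le_m; have := (P (ω l)).m_lt_n; omega) k).ne'
    ext t
    fin_cases t
    · simp only [Pattern.map, scale_succ, digitSum, h1]
      simp
      field_simp
      ring
    · simp only [Pattern.map, scale_succ, digitSum, h2]
      simp
      field_simp
      ring

lemma carpet_eq_digitCarpet {N : ℕ} (P : Fin N → Pattern) (ω : ℕ → Fin N) :
    carpet P ω = digitCarpet fun l => P (ω l) := by
  have hM : ∀ k, (0 : ℝ) < scale (fun l => (P (ω l)).m) k := fun k => by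
    exact_mod_cast (scale_pos (fun l => by have := (P (ω l)).two_le_m; omega) k)
  have hN : ∀ k, (0 : ℝ) < scale (fun l => (P (ω l)).n) k := fun k => by
    exact_mod_cast (scale_pos
        (fun l => by have := (P (ω l)).two_le_m; have := (P (ω l)).m_lt_n; omega) k)
  ext z
  simp only [carpet, attractor, Set.mem_iInter, Set.mem_iUnion, digitCarpet, Set.mem_ofPred_eq]
  refine forall_congr' fun k => ⟨?_, ?_⟩
  · rintro ⟨j, w, hw, rfl⟩
    -- Only the first `k` cells are prescribed; arbitrary cells fill the later positions.
    choose c hc using fun l => (P (ω l)).natCells_nonempty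
    obtain ⟨a, b, hmem, ha, hb⟩ : ∃ a b : ℕ → ℕ, (∀ l, (a l, b l) ∈ (P (ω l)).natCells) ∧
        (∀ l : Fin k, a l = (j l).1.1) ∧ ∀ l : Fin k, b l = (j l).1.2 := by
      refine ⟨fun l => if h : l < k then ((j ⟨l, h⟩).1.1 : ℕ) else (c l).1,
        fun l => if h : l < k then ((j ⟨l, h⟩).1.2 : ℕ) else (c l).2, fun l => ?_,
        fun l => dif_pos l.2, fun l => dif_pos l.2⟩
      by_cases h : l < k
      · simp only [h, dite_true]
        exact Finset.mem_image.2 ⟨(j ⟨l, h⟩).1, (j ⟨l, h⟩).2, rfl⟩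
      · simp only [h, dite_false]
        exact hc l
    refine ⟨a, b, hmem, ?_⟩
    rw [wordMap_apply P ω k j a b ha hb]
    have h0 := hw 0
    have h1 := hw 1
    have := hM k
    have := hN k
    simp only [strip, Set.mem_Icc] at h0 h1 ⊢
    refine ⟨⟨?_, ?_⟩, ?_, ?_⟩ <;> simp <;> gcongr <;> linarith
  · rintro ⟨a, b, hc, h0, h1⟩
    choose c hc hcab using fun l => Finset.mem_image.1 (hc l)
    refine ⟨fun l => ⟨c l, hc l⟩, !₂[z 0 * scale (fun l => (P (ω l)).m) k -
      digitSum (fun l => (P (ω l)).m) a k, z 1 * scale (fun l => (P (ω l)).n) k -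
      digitSum (fun l => (P (ω l)).n) b k], ?_, ?_⟩
    · simp only [strip, Set.mem_Icc, div_le_iff₀ (hM k), le_div_iff₀ (hM k), div_le_iff₀ (hN k),
        le_div_iff₀ (hN k)] at h0 h1
      intro t
      fin_cases t
      · simp; constructor <;> linarith
      · simp; constructor <;> linarith
    · rw [wordMap_apply P ω k _ a b (fun l => (congrArg Prod.fst (hcab l)).symm)
        (fun l => (congrArg Prod.snd (hcab l)).symm)]
      ext t
      fin_cases t
      · simp [(hM k).ne']
      · simp [(hN k).ne']

/-! ### The upper bound -/

lemma dist_le_add (z w : EuclideanSpace ℝ (Fin 2)) :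
    dist z w ≤ |z 0 - w 0| + |z 1 - w 1| := by
  rw [EuclideanSpace.dist_eq, Fin.sum_univ_two, Real.dist_eq, Real.dist_eq]
  apply Real.sqrt_le_iff.2 ⟨by positivity, ?_⟩
  nlinarith [mul_nonneg (abs_nonneg (z 0 - w 0)) (abs_nonneg (z 1 - w 1))]

lemma abs_sub_le_dist (z w : EuclideanSpace ℝ (Fin 2)) (t : Fin 2) : |z t - w t| ≤ dist z w := by
  rw [EuclideanSpace.dist_eq, ← Real.dist_eq]
  apply Real.le_sqrt_of_sq_le
  exact Finset.single_le_sum (f := fun t => dist (z t) (w t) ^ 2) (fun _ _ => by positivity)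
    (Finset.mem_univ t)

lemma coverNumber_le_card {X ι : Type*} [MetricSpace X] {r : ℝ} {E : Set X} (s : Finset ι)
    (f : ι → Set X) (hf : ∀ i ∈ s, Metric.ediam (f i) ≤ ENNReal.ofReal r)
    (hE : E ⊆ ⋃ i ∈ s, f i) : coverNumber r E ≤ s.card := by
  classical
  have h : (∀ V ∈ f '' s, Metric.ediam V ≤ ENNReal.ofReal r) ∧ E ⊆ ⋃₀ (f '' s) := by
    refine ⟨?_, by rwa [Set.sUnion_image]⟩
    rintro _ ⟨i, hi, rfl⟩
    exact hf i hi
  exact iInf₂_le_of_le _ h ((Set.encard_image_le f _).trans (Set.encard_coe_eq_coe_finsetCard s).le)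

/-- The integers `w` such that `[w / M, (w + 1) / M]` may meet `[x - R, x + R]`. -/
def nearby (M x R : ℝ) : Finset ℕ := Finset.Icc ⌈M * (x - R) - 1⌉₊ ⌊M * (x + R)⌋₊

lemma mem_nearby {M x R y : ℝ} {w : ℕ} (hM : 0 < M) (hy : |y - x| ≤ R)
    (hw : y ∈ Set.Icc ((w : ℝ) / M) ((w + 1) / M)) : w ∈ nearby M x R := by
  obtain ⟨h1, h2⟩ := hw
  rw [div_le_iff₀ hM] at h1
  rw [le_div_iff₀ hM] at h2
  obtain ⟨h3, h4⟩ := abs_le.1 hy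
  refine Finset.mem_Icc.2 ⟨Nat.ceil_le.2 ?_, Nat.le_floor ?_⟩ <;> nlinarith

lemma card_nearby_le {M x R : ℝ} (hM : 0 < M) (hR : 0 < R) :
    ((nearby M x R).card : ℝ) ≤ 2 * (M * R) + 2 := by
  have hMR : 0 < M * R := mul_pos hM hR
  rw [nearby, Nat.card_Icc]
  rcases le_total (⌈M * (x - R) - 1⌉₊) (⌊M * (x + R)⌋₊ + 1) with h | h
  · rw [Nat.cast_sub h]
    push_cast
    have h1 := Nat.le_ceil (M * (x - R) - 1)
    rcases le_total 0 (M * (x + R)) with h0 | h0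
    · have h2 := Nat.floor_le h0
      nlinarith
    · rw [Nat.floor_of_nonpos h0]
      have : (0 : ℝ) ≤ ⌈M * (x - R) - 1⌉₊ := by positivity
      push_cast
      linarith
  · rw [Nat.sub_eq_zero_of_le h]
    push_cast
    linarith

lemma prod_le_scale_div_rpow {q c : ℕ → ℕ} {α : ℝ} (hq : ∀ l, 0 < q l)
    (hc : ∀ l, (c l : ℝ) ≤ (q l : ℝ) ^ α) (k s : ℕ) :
    ((∏ l ∈ Finset.range s, c (k + l) : ℕ) : ℝ) ≤
      ((scale q (k + s) : ℝ) / scale q k) ^ α := by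
  have h : (scale q k : ℝ) ≠ 0 := by exact_mod_cast (scale_pos hq k).ne'
  rw [scale_add]
  push_cast
  rw [mul_div_cancel_left₀ _ h, ← Real.finsetProd_rpow _ _ fun _ _ => by positivity]
  exact Finset.prod_le_prod (fun _ _ => by positivity) fun l _ => hc _

/-- The scale at `k` overshoots `2 / R` by at most a factor `C`, so at most `4 * C + 2` starting
integers occur. The overshoot at the fine end costs the factor `C ^ α`. -/
lemma card_extensions_window_le {q : ℕ → ℕ} {E : ℕ → Finset ℕ} {S : Finset ℕ} {k s C : ℕ}
    {α r R : ℝ} (hα : 0 ≤ α) (hq : ∀ l, 0 < q l) (hE : ∀ l, ((E l).card : ℝ) ≤ (q l : ℝ) ^ α)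
    (hr : 0 < r) (hR : 0 < R) (hS : (S.card : ℝ) ≤ 2 * (scale q k * R) + 2)
    (h1 : 2 / R ≤ scale q k) (h2 : (scale q k : ℝ) ≤ C * (2 / R))
    (h3 : (scale q (k + s) : ℝ) ≤ C * (2 / r)) :
    ((extensions q E k S s).card : ℝ) ≤ (4 * C + 2) * (C : ℝ) ^ α * (R / r) ^ α := by
  have hM : (0 : ℝ) < scale q k := by exact_mod_cast scale_pos hq k
  have hS' : (S.card : ℝ) ≤ 4 * C + 2 := by
    have : scale q k * R ≤ C * 2 := by
      calc scale q k * R ≤ C * (2 / R) * R := by gcongr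
        _ = C * 2 := by field_simp
    linarith
  have h4 : (scale q (k + s) : ℝ) / scale q k ≤ C * (R / r) := by
    calc (scale q (k + s) : ℝ) / scale q k ≤ C * (2 / r) / (2 / R) := by gcongr
      _ = C * (R / r) := by field_simp
  calc ((extensions q E k S s).card : ℝ)
      ≤ ((S.card * ∏ l ∈ Finset.range s, (E (k + l)).card : ℕ) : ℝ) := by
        exact_mod_cast card_extensions_le q E k S s
    _ ≤ (4 * C + 2) * ((scale q (k + s) : ℝ) / scale q k) ^ α := by
        rw [Nat.cast_mul]
        exact mul_le_mul hS' (prod_le_scale_div_rpow (c := fun l => (E l).card) hq hE k s)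
          (by positivity) (by positivity)
    _ ≤ (4 * C + 2) * (C * (R / r)) ^ α := by gcongr
    _ = _ := by rw [Real.mul_rpow (by positivity) (by positivity)]; ring

lemma Pattern.two_le_n (P : Pattern) : 2 ≤ P.n := P.two_le_m.trans P.m_lt_n.le

theorem assouadAdmissible_digitCarpet {Q : ℕ → Pattern} {C : ℕ} (hC : ∀ l, (Q l).n ≤ C)
    {α β : ℝ} (hα : 0 ≤ α) (hβ : 0 ≤ β) (hA : ∀ l, ((Q l).A : ℝ) ≤ ((Q l).m : ℝ) ^ α)
    (hB : ∀ l, ((Q l).B : ℝ) ≤ ((Q l).n : ℝ) ^ β) :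
    AssouadAdmissible (digitCarpet Q) (α + β) := by
  have hm2 : ∀ l, 2 ≤ (Q l).m := fun l => (Q l).two_le_m
  have hn2 : ∀ l, 2 ≤ (Q l).n := fun l => (Q l).two_le_n
  have hm0 : ∀ l, 0 < (Q l).m := fun l => two_pos.trans_le (hm2 l)
  have hn0 : ∀ l, 0 < (Q l).n := fun l => two_pos.trans_le (hn2 l)
  have hmC : ∀ l, (Q l).m ≤ C := fun l => (Q l).m_lt_n.le.trans (hC l)
  have hC0 : (0 : ℝ) < C := by exact_mod_cast (hn0 0).trans_le (hC 0)
  set m := fun l => (Q l).m with hm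
  set n := fun l => (Q l).n with hn
  refine ⟨((4 * C + 2) * (C : ℝ) ^ α) * ((4 * C + 2) * (C : ℝ) ^ β), by positivity, 1, one_pos,
    fun r R hr hrR hR x hx => ?_⟩
  have hR0 : 0 < R := hr.trans hrR
  have hT : 2 / R ≤ 2 / r := by gcongr
  have hT1 : 1 ≤ 2 / R := by rw [le_div_iff₀ hR0]; linarith
  obtain ⟨K, hK1, hK2, hK3⟩ := exists_level (q := m) hm2 hmC hT1
  obtain ⟨k, hk1, hk2, hk3⟩ := exists_level (q := n) hn2 hC hT1
  obtain ⟨K', hK1', hK2', hK3'⟩ := exists_level (q := m) hm2 hmC (hT1.trans hT)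
  obtain ⟨k', hk1', hk2', hk3'⟩ := exists_level (q := n) hn2 hC (hT1.trans hT)
  have hKK : K ≤ K' := not_lt.1 fun h => (hK3 _ h).not_ge (hT.trans hK1')
  have hkk : k ≤ k' := not_lt.1 fun h => (hk3 _ h).not_ge (hT.trans hk1')
  -- Row scales grow at least as fast as column scales, so the column index at level `K'` fixes the
  -- column digit at every position of the row window.
  have hkK : k' ≤ K' := not_lt.1 fun h => (hk3' _ h).not_ge <| hK1'.trans <| by
    exact_mod_cast Finset.prod_le_prod' fun l _ => (Q l).m_lt_n.le
  obtain ⟨s, rfl⟩ := Nat.exists_eq_add_of_le hKK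
  obtain ⟨s', rfl⟩ := Nat.exists_eq_add_of_le hkk
  have hMK : (0 : ℝ) < scale m K := by exact_mod_cast scale_pos hm0 K
  have hNk : (0 : ℝ) < scale n k := by exact_mod_cast scale_pos hn0 k
  -- A digit sequence decoding `u`; the default 0 is harmless because the bound on the number of
  -- rows holds for every column.
  have hrep : ∀ u, ∃ a : ℕ → ℕ, (∃ a', (∀ l, a' l < m l) ∧ digitSum m a' (K + s) = u) →
      (∀ l, a l < m l) ∧ digitSum m a (K + s) = u := by
    intro u
    by_cases h : ∃ a', (∀ l, a' l < m l) ∧ digitSum m a' (K + s) = u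
    · exact ⟨h.choose, fun _ => h.choose_spec⟩
    · exact ⟨0, fun h' => absurd h' h⟩
  choose rep hrep using hrep
  let U := extensions m (fun l => (Q l).natCells.image Prod.fst) K (nearby (scale m K) (x 0) R) s
  let V := fun u => extensions n (fun l => (Q l).rows (rep u l)) k (nearby (scale n k) (x 1) R) s'
  have hU : (U.card : ℝ) ≤ (4 * C + 2) * (C : ℝ) ^ α * (R / r) ^ α :=
    card_extensions_window_le hα hm0 (fun l => by rw [Pattern.card_columns]; exact hA l) hr hR0
      (card_nearby_le hMK hR0) hK1 hK2 hK2'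
  have hV : ∀ u, ((V u).card : ℝ) ≤ (4 * C + 2) * (C : ℝ) ^ β * (R / r) ^ β := fun u =>
    card_extensions_window_le hβ hn0
      (fun l => (Nat.cast_le.2 (Pattern.card_rows_le _ _)).trans (hB l)) hr hR0
      (card_nearby_le hNk hR0) hk1 hk2 hk2'
  let f : (Σ _ : ℕ, ℕ) → Set (EuclideanSpace ℝ (Fin 2)) := fun p =>
    {z | z 0 ∈ Set.Icc ((p.1 : ℝ) / scale m (K + s)) ((p.1 + 1) / scale m (K + s)) ∧
      z 1 ∈ Set.Icc ((p.2 : ℝ) / scale n (k + s')) ((p.2 + 1) / scale n (k + s'))}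
  have hcover : coverNumber r (Metric.closedBall x R ∩ digitCarpet Q) ≤ (U.sigma V).card := by
    refine coverNumber_le_card _ f ?_ ?_
    · intro p _
      refine Metric.ediam_le fun z hz w hw => ?_
      rw [edist_dist]
      refine ENNReal.ofReal_le_ofReal ((dist_le_add z w).trans ?_)
      have h1 := Real.dist_le_of_mem_Icc hz.1 hw.1
      have h2 := Real.dist_le_of_mem_Icc hz.2 hw.2
      rw [← sub_div, add_sub_cancel_left, Real.dist_eq] at h1 h2
      -- The threshold `2 / r` makes both sides of a cell at most `r / 2`, so its diameter is at
      -- most `r`.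
      have h3 : 1 / (scale m (K + s) : ℝ) ≤ r / 2 := by
        rw [← one_div_div 2 r]; exact one_div_le_one_div_of_le (by positivity) hK1'
      have h4 : 1 / (scale n (k + s') : ℝ) ≤ r / 2 := by
        rw [← one_div_div 2 r]; exact one_div_le_one_div_of_le (by positivity) hk1'
      linarith
    · rintro z ⟨hzx, hz⟩
      obtain ⟨a, b, hab, hza, hzb⟩ := hz (K + s)
      have ha : ∀ l, a l < m l := fun l => (Pattern.lt_of_mem_natCells (hab l)).1
      have hb : ∀ l, b l < n l := fun l => (Pattern.lt_of_mem_natCells (hab l)).2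
      obtain ⟨hr1, hr2⟩ := hrep _ ⟨a, ha, rfl⟩
      have hrep_eq := digit_eq_of_digitSum_eq hr1 ha hr2
      refine Set.mem_iUnion₂.2 ⟨⟨digitSum m a (K + s), digitSum n b (k + s')⟩,
        Finset.mem_sigma.2 ⟨digitSum_mem_extensions ?_ ?_, digitSum_mem_extensions ?_ ?_⟩, hza,
          strip_antitone hb hkK hzb⟩
      · exact mem_nearby hMK ((abs_sub_le_dist z x 0).trans hzx) (strip_antitone ha hKK hza)
      · exact fun l _ => Finset.mem_image_of_mem Prod.fst (hab (K + l))
      · exact mem_nearby hNk ((abs_sub_le_dist z x 1).trans hzx)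
          (strip_antitone hb (hkk.trans hkK) hzb)
      · intro l hl
        rw [Pattern.mem_rows, hrep_eq (k + l) (by omega)]
        exact hab (k + l)
  have hcard : ((U.sigma V).card : ℝ) ≤ ((4 * C + 2) * (C : ℝ) ^ α) *
      ((4 * C + 2) * (C : ℝ) ^ β) * (R / r) ^ (α + β) := by
    rw [Finset.card_sigma, Real.rpow_add (by positivity)]
    push_cast
    calc ∑ u ∈ U, ((V u).card : ℝ) ≤ ∑ u ∈ U, (4 * C + 2) * (C : ℝ) ^ β * (R / r) ^ β :=
          Finset.sum_le_sum fun u _ => hV u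
      _ = U.card * ((4 * C + 2) * (C : ℝ) ^ β * (R / r) ^ β) := by simp
      _ ≤ ((4 * C + 2) * (C : ℝ) ^ α * (R / r) ^ α) *
          ((4 * C + 2) * (C : ℝ) ^ β * (R / r) ^ β) := by gcongr
      _ = _ := by ring
  calc (coverNumber r (Metric.closedBall x R ∩ digitCarpet Q) : ENNReal)
      ≤ ((U.sigma V).card : ENNReal) := by exact_mod_cast hcover
    _ = ENNReal.ofReal ((U.sigma V).card : ℝ) := (ENNReal.ofReal_natCast _).symm
    _ ≤ _ := ENNReal.ofReal_le_ofReal hcard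

/-! ### The lower bound -/

/-- Pigeonhole: a covering set of diameter at most `r` contains at most `c` of the indexed points.
-/
lemma card_le_mul_coverNumber {X ι : Type*} [MetricSpace X] [DecidableEq ι] {r : ℝ} {E : Set X}
    {c : ℕ} (hr : 0 ≤ r) (hc : 0 < c) (I : Finset ι) (pt : ι → X) (hpt : ∀ i ∈ I, pt i ∈ E)
    (hsep : ∀ i ∈ I, ∃ J : Finset ι, J.card ≤ c ∧ ∀ i' ∈ I, dist (pt i') (pt i) ≤ r → i' ∈ J) :
    (I.card : ℕ∞) ≤ c * coverNumber r E := by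
  classical
  by_cases htop : coverNumber r E = ⊤
  · rw [htop, ENat.mul_top (by exact_mod_cast hc.ne')]
    exact le_top
  have hlt : coverNumber r E < coverNumber r E + 1 :=
    (ENat.lt_add_one_iff htop).2 le_rfl
  obtain ⟨W, hW⟩ := iInf_lt_iff.1 hlt
  obtain ⟨⟨hW1, hW2⟩, hW3⟩ := iInf_lt_iff.1 hW
  have hWle := (ENat.lt_add_one_iff htop).1 hW3
  have hfin : W.Finite := Set.encard_ne_top_iff.1 fun h => htop (top_le_iff.1 (h ▸ hWle))
  lift W to Finset (Set X) using hfin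
  have hI : I ⊆ W.biUnion fun V => I.filter fun i => pt i ∈ V := fun i hi => by
    obtain ⟨V, hV, hiV⟩ := hW2 (hpt i hi)
    exact Finset.mem_biUnion.2 ⟨V, hV, Finset.mem_filter.2 ⟨hi, hiV⟩⟩
  have hcard : I.card ≤ W.card * c := by
    refine (Finset.card_le_card hI).trans (Finset.card_biUnion_le_card_mul _ _ _ fun V hV => ?_)
    rcases (I.filter fun i => pt i ∈ V).eq_empty_or_nonempty with h | ⟨i, hi⟩
    · simp [h]
    · obtain ⟨hiI, hiV⟩ := Finset.mem_filter.1 hi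
      obtain ⟨J, hJc, hJ⟩ := hsep i hiI
      refine (Finset.card_le_card fun i' hi' => ?_).trans hJc
      obtain ⟨hiI', hiV'⟩ := Finset.mem_filter.1 hi'
      refine hJ i' hiI' ?_
      have := (Metric.edist_le_ediam_of_mem hiV' hiV).trans (hW1 V hV)
      rwa [edist_dist, ENNReal.ofReal_le_ofReal_iff hr] at this
  rw [Set.encard_coe_eq_coe_finsetCard] at hWle
  calc (I.card : ℕ∞) ≤ c * W.card := by rw [mul_comm]; exact_mod_cast hcard
    _ ≤ _ := by gcongr

lemma le_add_of_mem_Icc_div {M r x y : ℝ} {u v c : ℕ} (hM : 0 < M) (hr : M * r ≤ c)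
    (hx : x ∈ Set.Icc ((u : ℝ) / M) ((u + 1) / M)) (hy : y ∈ Set.Icc ((v : ℝ) / M) ((v + 1) / M))
    (h : |x - y| ≤ r) : u ∈ Finset.Icc (v - (c + 1)) (v + (c + 1)) := by
  simp only [Set.mem_Icc, div_le_iff₀ hM, le_div_iff₀ hM] at hx hy
  obtain ⟨h1, h2⟩ := abs_le.1 h
  have h3 : (u : ℝ) ≤ v + (c + 1) := by nlinarith
  have h4 : (v : ℝ) ≤ u + (c + 1) := by nlinarith
  have h3' : u ≤ v + (c + 1) := by exact_mod_cast h3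
  have h4' : v ≤ u + (c + 1) := by exact_mod_cast h4
  rw [Finset.mem_Icc]
  omega

lemma scale_add_of_const {q : ℕ → ℕ} {k t c : ℕ} (h : ∀ l < t, q (k + l) = c) :
    scale q (k + t) = scale q k * c ^ t := by
  rw [scale_add, Finset.prod_congr rfl fun l hl => h l (Finset.mem_range.1 hl)]
  simp

/-- In the row window the column digit is frozen at a fullest column of `P'` while the row digit
varies; in the column window the columns of `P` vary. Since `k + t ≤ K`, these choices do not
interfere. They yield points in a common approximate square, boundedly many of which lie near any
given one at the finer scale. -/
lemma exists_ball_coverNumber_ge {Q : ℕ → Pattern} {C : ℕ} {P P' : Pattern} {k K t t' : ℕ}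
    (hkK : k + t ≤ K)
    (hK1 : scale (fun l => (Q l).n) k ≤ scale (fun l => (Q l).m) K)
    (hK2 : scale (fun l => (Q l).m) K ≤ C * scale (fun l => (Q l).n) k)
    (hP' : ∀ l < t, Q (k + l) = P') (hP : ∀ l < t', Q (K + l) = P)
    (ht' : P.m ^ t' ≤ P'.n ^ t) :
    ∃ x ∈ digitCarpet Q, ((P.A ^ t' * P'.B ^ t : ℕ) : ℕ∞) ≤ ((2 * C + 3) * 5 : ℕ) *
      coverNumber (1 / scale (fun l => (Q l).n) (k + t))
        (Metric.closedBall x (2 / scale (fun l => (Q l).n) k) ∩ digitCarpet Q) := by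
  classical
  set m := fun l => (Q l).m with hm
  set n := fun l => (Q l).n with hn
  have hm0 : ∀ l, 0 < m l := fun l => two_pos.trans_le (Q l).two_le_m
  have hn0 : ∀ l, 0 < n l := fun l => two_pos.trans_le (Q l).two_le_n
  have hMs : scale m (K + t') = scale m K * P.m ^ t' :=
    scale_add_of_const fun l hl => by rw [hm]; simp only [hP l hl]
  have hNs : scale n (k + t) = scale n k * P'.n ^ t :=
    scale_add_of_const fun l hl => by rw [hn]; simp only [hP' l hl]
  have hMpos : ∀ k, (0 : ℝ) < scale m k := fun k => by exact_mod_cast scale_pos hm0 k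
  have hNpos : ∀ k, (0 : ℝ) < scale n k := fun k => by exact_mod_cast scale_pos hn0 k
  obtain ⟨a, ha⟩ := P'.exists_card_rows
  obtain ⟨b, hb⟩ : (P'.rows a).Nonempty := Finset.card_pos.1 (ha ▸ P'.one_le_B)
  have hab := Pattern.mem_rows.1 hb
  obtain ⟨c, hc, hck⟩ : ∃ c : ℕ → ℕ × ℕ, (∀ l, c l ∈ (Q l).natCells) ∧
      ∀ l < t, c (k + l) = (a, b) := by
    choose e he using fun l => (Q l).natCells_nonempty
    refine ⟨fun l => if k ≤ l ∧ l < k + t then (a, b) else e l, fun l => ?_, fun l hl => ?_⟩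
    · by_cases h : k ≤ l ∧ l < k + t
      · simp only [h, and_self, if_true]
        obtain ⟨s, rfl⟩ := Nat.exists_eq_add_of_le h.1
        rwa [hP' s (by omega)]
      · simp only [h, if_false]
        exact he l
    · simp [hl]
  let U := extensions m (fun _ => P.natCells.image Prod.fst) K {digitSum m (fun l => (c l).1) K} t'
  let V := extensions n (fun _ => P'.rows a) k {digitSum n (fun l => (c l).2) k} t
  have hU : U.card = P.A ^ t' := by
    rw [card_extensions, Finset.prod_const, P.card_columns]
    · simp
    · intro l hl d hd
      obtain ⟨e, he, rfl⟩ := Finset.mem_image.1 hd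
      simp only [hm, hP l hl]
      exact (Pattern.lt_of_mem_natCells he).1
  have hV : V.card = P'.B ^ t := by
    rw [card_extensions, Finset.prod_const, ha]
    · simp
    · intro l hl d hd
      simp only [hn, hP' l hl]
      exact (Pattern.lt_of_mem_natCells (Pattern.mem_rows.1 hd)).2
  have hpt : ∀ p ∈ U ×ˢ V, ∃ z ∈ digitCarpet Q,
      z 0 ∈ strip m (fun l => (c l).1) K ∧ z 1 ∈ strip n (fun l => (c l).2) k ∧
      z 0 ∈ Set.Icc ((p.1 : ℝ) / scale m (K + t')) ((p.1 + 1) / scale m (K + t')) ∧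
      z 1 ∈ Set.Icc ((p.2 : ℝ) / scale n (k + t)) ((p.2 + 1) / scale n (k + t)) := by
    rintro ⟨u, v⟩ huv
    obtain ⟨hu, hv⟩ := Finset.mem_product.1 huv
    obtain ⟨d, hd1, hd2, rfl⟩ := exists_digits_of_mem_extensions hu
    obtain ⟨e, he1, he2, rfl⟩ := exists_digits_of_mem_extensions hv
    -- From level `K` on, the row digit only has to complete the chosen column to a cell; it does
    -- not affect the row strip at level `k + t`.
    have hcells : ∀ l, ∃ f, (d l, f) ∈ (Q l).natCells ∧ (l < K → f = e l) := by
      intro l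
      rcases lt_or_ge l K with hl | hl
      · refine ⟨e l, ?_, fun _ => rfl⟩
        rw [hd1 l (Or.inl hl)]
        rcases Nat.lt_or_ge l k with h | h
        · rw [he1 l (Or.inl h)]
          exact hc l
        · obtain ⟨s, rfl⟩ := Nat.exists_eq_add_of_le h
          rcases Nat.lt_or_ge s t with hs | hs
          · rw [hck s hs, hP' s hs]
            exact Pattern.mem_rows.1 (he2 s hs)
          · rw [he1 (k + s) (Or.inr (by omega))]
            exact hc _
      · obtain ⟨s, rfl⟩ := Nat.exists_eq_add_of_le hl
        rcases Nat.lt_or_ge s t' with hs | hs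
        · obtain ⟨⟨f1, f2⟩, hf, hfd⟩ := Finset.mem_image.1 (hd2 s hs)
          rw [hP s hs, ← hfd]
          exact ⟨f2, hf, fun h => absurd h (by omega)⟩
        · rw [hd1 (K + s) (Or.inr (by omega))]
          exact ⟨_, hc _, fun h => absurd h (by omega)⟩
    choose f hf hfe using hcells
    have hdm : ∀ l, d l < m l := fun l => (Pattern.lt_of_mem_natCells (hf l)).1
    have hfn : ∀ l, f l < n l := fun l => (Pattern.lt_of_mem_natCells (hf l)).2
    obtain ⟨x, hx⟩ := exists_mem_strip hdm
    obtain ⟨y, hy⟩ := exists_mem_strip hfn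
    refine ⟨!₂[x, y], fun s => ⟨d, f, hf, hx s, hy s⟩, ?_, ?_, hx (K + t'), ?_⟩
    · have := hx K
      rwa [strip, digitSum_congr m fun l hl => hd1 l (Or.inl hl)] at this
    · have := hy k
      rwa [strip, digitSum_congr n fun l hl =>
        (hfe l (by omega)).trans (he1 l (Or.inl hl))] at this
    · have := hy (k + t)
      rwa [strip, digitSum_congr n fun l hl => hfe l (by omega)] at this
  choose! pt hptF hpt1 hpt2 hpt3 hpt4 using hpt
  obtain ⟨p₀, hp₀⟩ : (U ×ˢ V).Nonempty := by
    rw [← Finset.card_pos, Finset.card_product, hU, hV]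
    exact Nat.mul_pos (pow_pos P.one_le_A _) (pow_pos P'.one_le_B _)
  refine ⟨pt p₀, hptF p₀ hp₀, ?_⟩
  have hcardUV : (U ×ˢ V).card = P.A ^ t' * P'.B ^ t := by rw [Finset.card_product, hU, hV]
  rw [← hcardUV]
  refine card_le_mul_coverNumber (by positivity) (by positivity) _ pt
    (fun p hp => ⟨?_, hptF p hp⟩) fun p hp => ?_
  · rw [Metric.mem_closedBall]
    refine (dist_le_add _ _).trans ?_
    have h1 := Real.dist_le_of_mem_Icc (hpt1 p hp) (hpt1 p₀ hp₀)
    have h2 := Real.dist_le_of_mem_Icc (hpt2 p hp) (hpt2 p₀ hp₀)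
    rw [← sub_div, add_sub_cancel_left, Real.dist_eq] at h1 h2
    have h3 : 1 / (scale m K : ℝ) ≤ 1 / scale n k :=
      one_div_le_one_div_of_le (hNpos k) (by exact_mod_cast hK1)
    have h4 : 2 / (scale n k : ℝ) = 1 / scale n k + 1 / scale n k := by ring
    linarith
  · refine ⟨Finset.Icc (p.1 - (C + 1)) (p.1 + (C + 1)) ×ˢ Finset.Icc (p.2 - (1 + 1)) (p.2 + (1 + 1)),
      ?_, fun p' hp' hd => Finset.mem_product.2 ⟨?_, ?_⟩⟩
    · rw [Finset.card_product, Nat.card_Icc, Nat.card_Icc]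
      exact Nat.mul_le_mul (by omega) (by omega)
    · refine le_add_of_mem_Icc_div (hMpos _) ?_ (hpt3 p' hp') (hpt3 p hp)
        ((abs_sub_le_dist _ _ _).trans hd)
      rw [mul_one_div, div_le_iff₀ (hNpos _), hMs, hNs]
      calc ((scale m K * P.m ^ t' : ℕ) : ℝ) ≤ ((C * scale n k * P'.n ^ t : ℕ) : ℝ) := by
            exact_mod_cast Nat.mul_le_mul hK2 ht'
        _ = C * ((scale n k * P'.n ^ t : ℕ) : ℝ) := by push_cast; ring
    · refine le_add_of_mem_Icc_div (hNpos _) ?_ (hpt4 p' hp') (hpt4 p hp)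
        ((abs_sub_le_dist _ _ _).trans hd)
      rw [mul_one_div_cancel (hNpos _).ne']
      simp

/-- At arbitrarily small scales, the pattern `P'` is repeated `t` times where it governs the rows of
the approximate squares, and `P` is repeated for as long where it governs their columns. -/
def HasLongRuns (Q : ℕ → Pattern) (C : ℕ) (P P' : Pattern) : Prop :=
  ∀ t k₀, ∃ k ≥ k₀, ∃ K, k + t ≤ K ∧
    scale (fun l => (Q l).n) k ≤ scale (fun l => (Q l).m) K ∧
    scale (fun l => (Q l).m) K ≤ C * scale (fun l => (Q l).n) k ∧
    (∀ l < t, Q (k + l) = P') ∧ ∀ l < Nat.log P.m (P'.n ^ t), Q (K + l) = P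

theorem le_of_assouadAdmissible {Q : ℕ → Pattern} {C : ℕ} {P P' : Pattern}
    (hQ : HasLongRuns Q C P P') {α β γ : ℝ} (hα : 0 ≤ α)
    (hA : (P.A : ℝ) = (P.m : ℝ) ^ α) (hB : (P'.B : ℝ) = (P'.n : ℝ) ^ β)
    (h : AssouadAdmissible (digitCarpet Q) γ) : α + β ≤ γ := by
  obtain ⟨D, hD, ρ, hρ, h⟩ := h
  by_contra! hγ
  have hm0 : (0 : ℝ) < P.m := by exact_mod_cast two_pos.trans_le P.two_le_m
  have hn1 : (1 : ℝ) < P'.n := by exact_mod_cast one_lt_two.trans_le P'.two_le_n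
  have hn0 : (0 : ℝ) < P'.n := one_pos.trans hn1
  -- If `γ < α + β`, a long run makes `X ^ (α + β - γ)`, with `X = P'.n ^ t`, exceed every constant
  -- of the estimate. The factor `P.m ^ α` pays for rounding down in `Nat.log`.
  obtain ⟨t, ht⟩ := pow_unbounded_of_one_lt
    ((((2 * C + 3) * 5 : ℕ) : ℝ) * D * 2 ^ γ * (P.m : ℝ) ^ α)
    (Real.one_lt_rpow hn1 (sub_pos.2 hγ))
  -- Beyond level `k₀` the ball radius `2 / N` is at most `ρ`.
  obtain ⟨k₀, hk₀⟩ := pow_unbounded_of_one_lt (2 / ρ) (one_lt_two : (1 : ℝ) < 2)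
  obtain ⟨k, hk, K, hkK, hK1, hK2, hP', hP⟩ := hQ t k₀
  have hlog1 : P.m ^ Nat.log P.m (P'.n ^ t) ≤ P'.n ^ t :=
    Nat.pow_log_le_self _ (pow_pos (two_pos.trans_le P'.two_le_n) _).ne'
  have hlog2 : P'.n ^ t < P.m ^ (Nat.log P.m (P'.n ^ t) + 1) :=
    Nat.lt_pow_succ_log_self P.two_le_m _
  obtain ⟨x, hx, hcov⟩ := exists_ball_coverNumber_ge hkK hK1 hK2 hP' hP hlog1
  have hNpos : ∀ k, (0 : ℝ) < scale (fun l => (Q l).n) k := fun k => by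
    exact_mod_cast scale_pos (fun l => two_pos.trans_le (Q l).two_le_n) k
  have hNs : scale (fun l => (Q l).n) (k + t) = scale (fun l => (Q l).n) k * P'.n ^ t :=
    scale_add_of_const fun l hl => by simp only [hP' l hl]
  have hNk : (2 : ℝ) ^ k₀ ≤ scale (fun l => (Q l).n) k := by
    exact_mod_cast (Nat.pow_le_pow_right two_pos hk).trans
      (two_pow_le_scale (fun l => (Q l).two_le_n) k)
  have hX : (1 : ℝ) ≤ (P'.n : ℝ) ^ t := one_le_pow₀ hn1.le
  set N := (scale (fun l => (Q l).n) k : ℝ) with hN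
  set X := (P'.n : ℝ) ^ t with hXdef
  set s := Nat.log P.m (P'.n ^ t)
  have hN0 : 0 < N := hNpos k
  have hNs' : (scale (fun l => (Q l).n) (k + t) : ℝ) = N * X := by rw [hNs]; push_cast; rfl
  rw [hNs'] at hcov
  have hadm := h (1 / (N * X)) (2 / N) (by positivity)
    (by rw [div_lt_div_iff₀ (by positivity) hN0]; nlinarith)
    (by
      rw [div_le_iff₀ hN0]
      rw [div_lt_iff₀ hρ] at hk₀
      nlinarith) x hx
  have hratio : 2 / N / (1 / (N * X)) = 2 * X := by field_simp
  rw [hratio, Real.mul_rpow (by positivity) (by positivity)] at hadm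
  have hle : ((P.A ^ s * P'.B ^ t : ℕ) : ℝ) ≤
      (((2 * C + 3) * 5 : ℕ) : ℝ) * (D * (2 ^ γ * X ^ γ)) := by
    have h1 : ((P.A ^ s * P'.B ^ t : ℕ) : ENNReal) ≤
        ((2 * C + 3) * 5 : ℕ) * ENNReal.ofReal (D * (2 ^ γ * X ^ γ)) := by
      refine le_trans ?_ (mul_le_mul_right hadm _)
      exact_mod_cast ENat.toENNReal_le.2 hcov
    rw [← ENNReal.ofReal_natCast, ← ENNReal.ofReal_natCast ((2 * C + 3) * 5),
      ← ENNReal.ofReal_mul (by positivity)] at h1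
    exact (ENNReal.ofReal_le_ofReal_iff (by positivity)).1 h1
  have hAs : X ^ α ≤ (P.A : ℝ) ^ s * (P.m : ℝ) ^ α := by
    have h1 : X ≤ (P.m : ℝ) ^ s * P.m := by
      rw [← pow_succ, hXdef]; exact_mod_cast hlog2.le
    calc X ^ α ≤ ((P.m : ℝ) ^ s * P.m) ^ α := by gcongr
      _ = _ := by
        rw [Real.mul_rpow (by positivity) hm0.le, hA, ← Real.rpow_pow_comm hm0.le]
  have hBt : X ^ β = (P'.B : ℝ) ^ t := by rw [hB, Real.rpow_pow_comm hn0.le]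
  have hXδ : X ^ (α + β - γ) = ((P'.n : ℝ) ^ (α + β - γ)) ^ t := by
    rw [Real.rpow_pow_comm hn0.le]
  rw [← hXδ, Real.rpow_sub (by positivity), lt_div_iff₀ (by positivity),
    Real.rpow_add (by positivity)] at ht
  push_cast at hle ht
  have : X ^ α * X ^ β ≤ (P.A : ℝ) ^ s * (P.m : ℝ) ^ α * (P'.B : ℝ) ^ t := by
    rw [hBt]; gcongr
  have h5 := mul_le_mul_of_nonneg_right hle (by positivity : 0 ≤ (P.m : ℝ) ^ α)
  nlinarith

/-! ### Runs in Bernoulli sequences -/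

section Runs

variable {N : ℕ}

/-- Membership in `A` depends only on the first `s` letters. -/
def DeterminedBy (s : ℕ) (A : Set (ℕ → Fin N)) : Prop :=
  ∀ ω ω' : ℕ → Fin N, (∀ l < s, ω l = ω' l) → ω ∈ A → ω' ∈ A

lemma DeterminedBy.mono {s s' : ℕ} {A : Set (ℕ → Fin N)} (hA : DeterminedBy s A) (h : s ≤ s') :
    DeterminedBy s' A :=
  fun ω ω' hω => hA ω ω' fun l hl => hω l (hl.trans_le h)

lemma DeterminedBy.diff {s : ℕ} {A B : Set (ℕ → Fin N)} (hA : DeterminedBy s A)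
    (hB : DeterminedBy s B) : DeterminedBy s (A \ B) :=
  fun ω ω' hω h => ⟨hA ω ω' hω h.1, fun h' => h.2 (hB ω' ω (fun l hl => (hω l hl).symm) h')⟩

lemma DeterminedBy.eq_preimage {s : ℕ} {A : Set (ℕ → Fin N)} (hA : DeterminedBy s A) :
    A = (fun (ω : ℕ → Fin N) (l : Finset.range s) => ω l) ⁻¹'
      ((fun (ω : ℕ → Fin N) (l : Finset.range s) => ω l) '' A) := by
  refine subset_antisymm (Set.subset_preimage_image _ _) ?_
  rintro ω ⟨ω', hω', h⟩
  exact hA ω' ω (fun l hl => congrFun h ⟨l, Finset.mem_range.2 hl⟩) hω'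

lemma DeterminedBy.measurableSet {s : ℕ} {A : Set (ℕ → Fin N)} (hA : DeterminedBy s A) :
    MeasurableSet A := by
  rw [hA.eq_preimage]
  exact (measurable_pi_lambda _ fun l => measurable_pi_apply _) (Set.toFinite _).measurableSet

variable (p : PMF (Fin N))

instance : IsProbabilityMeasure (bernoulliMeasure p) := by
  unfold bernoulliMeasure; infer_instance

/-- The event is a cylinder over the coordinates below `s`, which are independent of coordinate `s`.
-/
lemma bernoulliMeasure_inter_eval {s : ℕ} {A : Set (ℕ → Fin N)} (hA : DeterminedBy s A)
    (i : Fin N) : bernoulliMeasure p (A ∩ {ω | ω s = i}) = bernoulliMeasure p A * p i := by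
  have hind := ProbabilityTheory.iIndepFun_infinitePi (P := fun _ : ℕ => p.toMeasure)
    (X := fun _ x => x) (fun _ => measurable_id)
  have h := (hind.indepFun_finset (Finset.range s) {s} (by simp)
    fun l => measurable_pi_apply l).measure_inter_preimage_eq_mul
      ((fun (ω : ℕ → Fin N) (l : Finset.range s) => ω l) '' A) {f | f ⟨s, by simp⟩ = i}
      (Set.toFinite _).measurableSet (Set.toFinite _).measurableSet
  rw [← hA.eq_preimage] at h
  refine h.trans ?_
  have h2 := (measurePreserving_eval_infinitePi (fun _ : ℕ => p.toMeasure) s).measure_preimage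
    (measurableSet_singleton i).nullMeasurableSet
  rw [PMF.toMeasure_apply_singleton _ _ (measurableSet_singleton i)] at h2
  rw [← h2]
  rfl

/-- The hypothesis says that `A` belongs to the past of `τ`. Splitting by the value of `τ` reduces
to a fixed time. -/
lemma bernoulliMeasure_inter_eval_stopping {A : Set (ℕ → Fin N)} {τ : (ℕ → Fin N) → ℕ}
    (hA : ∀ s, DeterminedBy s (A ∩ {ω | τ ω = s})) (i : Fin N) :
    bernoulliMeasure p (A ∩ {ω | ω (τ ω) = i}) = bernoulliMeasure p A * p i := by
  have hdisj : ∀ B : ℕ → Set (ℕ → Fin N),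
      Pairwise (Function.onFun Disjoint fun s => (A ∩ {ω | τ ω = s}) ∩ B s) := by
    intro B s s' hs
    refine Set.disjoint_left.2 fun ω h h' => hs ?_
    exact h.1.2.symm.trans h'.1.2
  have h1 : A = ⋃ s, A ∩ {ω | τ ω = s} ∩ Set.univ := by
    ext ω; simp
  have h2 : A ∩ {ω | ω (τ ω) = i} = ⋃ s, A ∩ {ω | τ ω = s} ∩ {ω | ω s = i} := by
    ext ω; simp [and_assoc]
  have hmeas : ∀ s, MeasurableSet {ω : ℕ → Fin N | ω s = i} := fun s =>
    measurableSet_eq_fun (measurable_pi_apply s) measurable_const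
  rw [h2, measure_iUnion (hdisj fun s => {ω | ω s = i}) fun s => (hA s).measurableSet.inter (hmeas s)]
  conv_rhs => rw [h1, measure_iUnion (hdisj fun _ => Set.univ) fun s => by simpa using (hA s).measurableSet]
  rw [← ENNReal.tsum_mul_right]
  exact tsum_congr fun s => by rw [bernoulliMeasure_inter_eval p (hA s), Set.inter_univ]

lemma determinedBy_inter_run {A : Set (ℕ → Fin N)} {τ : (ℕ → Fin N) → ℕ}
    (hA : ∀ s, DeterminedBy s (A ∩ {ω | τ ω = s})) (i : Fin N) (t s : ℕ) :
    DeterminedBy s ((A ∩ {ω | ∀ l < t, ω (τ ω + l) = i}) ∩ {ω | τ ω + t = s}) := by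
  rintro ω ω' hω ⟨⟨h1, h2⟩, h3⟩
  simp only [Set.mem_ofPred_eq] at h2 h3
  obtain ⟨h4, h5⟩ := hA (τ ω) ω ω' (fun l hl => hω l (by omega)) ⟨h1, rfl⟩
  simp only [Set.mem_ofPred_eq] at h5
  refine ⟨⟨h4, fun l hl => ?_⟩, ?_⟩
  · rw [h5, ← hω _ (by omega)]
    exact h2 l hl
  · simp only [Set.mem_ofPred_eq]
    omega

/-- The strong Markov property: a run of the letter `i` after the stopping time `τ` is independent
of the past of `τ`. -/
lemma bernoulliMeasure_inter_run {A : Set (ℕ → Fin N)} {τ : (ℕ → Fin N) → ℕ}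
    (hA : ∀ s, DeterminedBy s (A ∩ {ω | τ ω = s})) (i : Fin N) (t : ℕ) :
    bernoulliMeasure p (A ∩ {ω | ∀ l < t, ω (τ ω + l) = i}) =
      bernoulliMeasure p A * p i ^ t := by
  induction t with
  | zero => simp
  | succ t ih =>
    rw [pow_succ, ← mul_assoc, ← ih, ← bernoulliMeasure_inter_eval_stopping p
      (τ := fun ω => τ ω + t) (determinedBy_inter_run hA i t)]
    congr 1
    ext ω
    simp only [Set.mem_inter_iff, Set.mem_ofPred_eq, Nat.lt_succ_iff_lt_or_eq, or_imp,
      forall_and, forall_eq, and_assoc]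

/-! ### The level at which the columns catch up with the rows -/

variable (P : Fin N → Pattern)

/-- The first level at which the columns are at most as wide as the rows of level `k` are high. -/
def passage (k : ℕ) (ω : ℕ → Fin N) : ℕ :=
  sInf {s | scale (fun l => (P (ω l)).n) k ≤ scale (fun l => (P (ω l)).m) s}

lemma passage_spec (k : ℕ) (ω : ℕ → Fin N) :
    scale (fun l => (P (ω l)).n) k ≤ scale (fun l => (P (ω l)).m) (passage P k ω) :=
  Nat.sInf_mem (s := {s | scale (fun l => (P (ω l)).n) k ≤ scale (fun l => (P (ω l)).m) s})
    ⟨_, (Nat.lt_two_pow_self (n := scale (fun l => (P (ω l)).n) k)).le.trans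
      (two_pow_le_scale (fun l => (P (ω l)).two_le_m) _)⟩

lemma scale_lt_of_lt_passage {k s : ℕ} {ω : ℕ → Fin N} (h : s < passage P k ω) :
    scale (fun l => (P (ω l)).m) s < scale (fun l => (P (ω l)).n) k :=
  not_le.1 (Nat.notMem_of_lt_sInf
    (s := {s | scale (fun l => (P (ω l)).n) k ≤ scale (fun l => (P (ω l)).m) s}) h)

lemma passage_le {k s : ℕ} {ω : ℕ → Fin N}
    (h : scale (fun l => (P (ω l)).n) k ≤ scale (fun l => (P (ω l)).m) s) : passage P k ω ≤ s :=
  Nat.sInf_le h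

/-- This is the stopping time property: the passage level is decided by the letters before it and
before `k`. -/
lemma passage_congr {k : ℕ} {ω ω' : ℕ → Fin N} (hk : ∀ l < k, ω l = ω' l)
    (h : ∀ l < passage P k ω, ω l = ω' l) : passage P k ω' = passage P k ω := by
  have hN : scale (fun l => (P (ω l)).n) k = scale (fun l => (P (ω' l)).n) k :=
    scale_congr fun l hl => by rw [hk l hl]
  have hM : ∀ s ≤ passage P k ω,
      scale (fun l => (P (ω l)).m) s = scale (fun l => (P (ω' l)).m) s :=
    fun s hs => scale_congr fun l hl => by rw [h l (hl.trans_le hs)]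
  have hle : passage P k ω' ≤ passage P k ω :=
    passage_le P (by rw [← hN, ← hM _ le_rfl]; exact passage_spec P k ω)
  refine le_antisymm hle (passage_le P ?_)
  rw [hN, hM _ hle]
  exact passage_spec P k ω'

variable {P} {C : ℕ}

lemma passage_le_mul (hC : ∀ i, (P i).n ≤ C) (k : ℕ) (ω : ℕ → Fin N) :
    passage P k ω ≤ C * k := by
  refine passage_le P ((scale_le_pow (fun l => hC _) k).trans ?_)
  refine le_trans ?_ (two_pow_le_scale (fun l => (P (ω l)).two_le_m) _)
  rw [pow_mul]
  exact Nat.pow_le_pow_left Nat.lt_two_pow_self.le k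

/-- Each level multiplies the ratio of the row scale to the column scale by at least 1 + 1/C, so the
ratio is at least 1 + k/C. Linear growth is enough to separate the two windows. -/
lemma scale_mul_add_le {m n : ℕ → ℕ} (hmn : ∀ l, m l < n l) (hn : ∀ l, n l ≤ C) (k : ℕ) :
    scale m k * (C + k) ≤ scale n k * C := by
  induction k with
  | zero => simp
  | succ k ih =>
    rw [scale_succ, scale_succ]
    have h1 : m k ≤ C := (hmn k).le.trans (hn k)
    calc scale m k * m k * (C + (k + 1)) = scale m k * (m k * (C + k) + m k) := by ring
      _ ≤ scale m k * (m k * (C + k) + (C + k)) := by gcongr; omega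
      _ = scale m k * (C + k) * (m k + 1) := by ring
      _ ≤ scale n k * C * n k := Nat.mul_le_mul ih (hmn k)
      _ = scale n k * n k * C := by ring

/-- Otherwise `t` further column digits, worth at most a factor `C ^ t`, would close a gap of at
least 1 + k/C. -/
lemma add_lt_passage (hC : ∀ i, (P i).n ≤ C) {k t : ℕ} (hk : C ^ (t + 1) ≤ k) (ω : ℕ → Fin N) :
    k + t < passage P k ω := by
  have hC0 : 0 < C := (two_pos.trans_le (P (ω 0)).two_le_n).trans_le (hC _)
  have hpos : ∀ l, 0 < (P (ω l)).m := fun l => two_pos.trans_le (P (ω l)).two_le_m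
  by_contra! h
  have h1 := (passage_spec P k ω).trans (scale_mono hpos h)
  have h2 := scale_mul_add_le (m := fun l => (P (ω l)).m) (n := fun l => (P (ω l)).n)
    (fun l => (P (ω l)).m_lt_n) (fun l => hC _) k
  have h3 : scale (fun l => (P (ω l)).m) (k + t) ≤ scale (fun l => (P (ω l)).m) k * C ^ t := by
    rw [scale_add]
    gcongr
    simpa using Finset.prod_le_prod' (s := Finset.range t) (f := fun l => (P (ω (k + l))).m)
      (g := fun _ => C) fun l _ => (P _).m_lt_n.le.trans (hC _)
  have h4 : scale (fun l => (P (ω l)).m) k * (C + k) ≤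
      scale (fun l => (P (ω l)).m) k * C ^ (t + 1) := by
    calc _ ≤ _ := h2
      _ ≤ _ := Nat.mul_le_mul_right C (h1.trans h3)
      _ = _ := by ring
  have := Nat.le_of_mul_le_mul_left h4 (scale_pos hpos k)
  omega

variable (P) in
/-- The event of a run of `t` letters `j` from position `k` on, and a run of `t'` letters `i` from
the corresponding column level on. -/
def doubleRun (i j : Fin N) (t t' k : ℕ) : Set (ℕ → Fin N) :=
  {ω | ∀ l < t, ω (k + l) = j} ∩ {ω | ∀ l < t', ω (passage P k ω + l) = i}

lemma determinedBy_doubleRun (hC : ∀ i, (P i).n ≤ C) (i j : Fin N) (t t' k : ℕ) :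
    DeterminedBy ((C + 1) * k + t + t') (doubleRun P i j t t' k) := by
  rintro ω ω' hω ⟨h1, h2⟩
  have hp := passage_le_mul hC k ω
  have hbound : (C + 1) * k = C * k + k := by ring
  have heq : passage P k ω' = passage P k ω :=
    passage_congr P (fun l hl => hω l (by omega)) fun l hl => hω l (by omega)
  refine ⟨fun l hl => ?_, fun l hl => ?_⟩
  · rw [← hω _ (by omega)]; exact h1 l hl
  · rw [heq, ← hω _ (by omega)]; exact h2 l hl

/-- The Markov property is used twice, at the constant time `k` and at the passage level. The bound
on `k` ends the first run before the passage level, so that run belongs to its past. -/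
lemma bernoulliMeasure_inter_doubleRun (hC : ∀ i, (P i).n ≤ C) (i j : Fin N) {t t' k : ℕ}
    (hk : C ^ (t + 1) ≤ k) {G : Set (ℕ → Fin N)} (hG : DeterminedBy k G) :
    bernoulliMeasure p (G ∩ doubleRun P i j t t' k) =
      bernoulliMeasure p G * p j ^ t * p i ^ t' := by
  have hG' : ∀ s, DeterminedBy s (G ∩ {_ω | k = s}) := by
    rintro s ω ω' hω ⟨h1, h2⟩
    obtain rfl : k = s := h2
    exact ⟨hG ω ω' hω h1, rfl⟩
  rw [doubleRun, ← Set.inter_assoc, ← bernoulliMeasure_inter_run p (τ := fun _ => k) hG' j t]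
  refine bernoulliMeasure_inter_run p (fun s => ?_) i t'
  rintro ω ω' hω ⟨⟨h1, h2⟩, h3⟩
  obtain rfl : passage P k ω = s := h3
  have hlt := add_lt_passage hC hk ω
  refine ⟨⟨hG ω ω' (fun l hl => hω l (by omega)) h1, fun l hl => ?_⟩,
    passage_congr P (fun l hl => hω l (by omega)) hω⟩
  rw [← hω _ (by omega)]
  exact h2 l hl

/-- `G` is the event that `M` trials at increasing levels all fail. Each new trial starts beyond
every letter inspected so far, so it contributes an independent factor. -/
lemma exists_determinedBy_measure_le (hC : ∀ i, (P i).n ≤ C) (i j : Fin N) (t t' k₀ M : ℕ) :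
    ∃ k G, C ^ (t + 1) ≤ k ∧ k₀ ≤ k ∧ DeterminedBy k G ∧
      {ω | ∀ k ≥ k₀, C ^ (t + 1) ≤ k → ω ∉ doubleRun P i j t t' k} ⊆ G ∧
      (bernoulliMeasure p).real G ≤ (1 - (p j ^ t * p i ^ t').toReal) ^ M := by
  induction M with
  | zero =>
    exact ⟨max (C ^ (t + 1)) k₀, Set.univ, le_max_left _ _, le_max_right _ _,
      fun _ _ _ _ => trivial, Set.subset_univ _, by simp⟩
  | succ M ih =>
    obtain ⟨k, G, hk, hk0, hG, hsub, hle⟩ := ih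
    have hbound : k ≤ (C + 1) * k + t + t' := by nlinarith
    have hE := determinedBy_doubleRun hC i j t t' k
    refine ⟨(C + 1) * k + t + t', G \ doubleRun P i j t t' k, hk.trans hbound, hk0.trans hbound,
      (hG.mono hbound).diff hE, fun ω hω => ⟨hsub hω, hω k hk0 hk⟩, ?_⟩
    have h1 := measureReal_inter_add_sdiff (μ := bernoulliMeasure p) (s := G) hE.measurableSet
    have h2 : (bernoulliMeasure p).real (G ∩ doubleRun P i j t t' k) =
        (bernoulliMeasure p).real G * (p j ^ t * p i ^ t').toReal := by
      rw [Measure.real, bernoulliMeasure_inter_doubleRun p hC i j hk hG, mul_assoc,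
        ENNReal.toReal_mul, Measure.real]
    have h3 : (p j ^ t * p i ^ t').toReal ≤ 1 :=
      ENNReal.toReal_le_of_le_ofReal zero_le_one (by
        rw [ENNReal.ofReal_one]
        exact mul_le_one' (pow_le_one' (p.coe_le_one j) t) (pow_le_one' (p.coe_le_one i) t'))
    calc (bernoulliMeasure p).real (G \ doubleRun P i j t t' k)
        = (bernoulliMeasure p).real G * (1 - (p j ^ t * p i ^ t').toReal) := by linarith
      _ ≤ (1 - (p j ^ t * p i ^ t').toReal) ^ M * (1 - (p j ^ t * p i ^ t').toReal) :=
        mul_le_mul_of_nonneg_right hle (sub_nonneg.2 h3)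
      _ = _ := (pow_succ _ _).symm

lemma ae_exists_doubleRun (hp : ∀ i, 0 < p i) (hC : ∀ i, (P i).n ≤ C) (i j : Fin N)
    (t t' k₀ : ℕ) : ∀ᵐ ω ∂(bernoulliMeasure p),
      ∃ k ≥ k₀, C ^ (t + 1) ≤ k ∧ ω ∈ doubleRun P i j t t' k := by
  set c := (p j ^ t * p i ^ t').toReal with hc
  have hc0 : 0 < c := ENNReal.toReal_pos
    (mul_ne_zero (pow_ne_zero _ (hp j).ne') (pow_ne_zero _ (hp i).ne'))
    (ENNReal.mul_ne_top (ENNReal.pow_ne_top (p.apply_ne_top j))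
      (ENNReal.pow_ne_top (p.apply_ne_top i)))
  have hc1 : c ≤ 1 := ENNReal.toReal_le_of_le_ofReal zero_le_one (by
    rw [ENNReal.ofReal_one]
    exact mul_le_one' (pow_le_one' (p.coe_le_one j) t) (pow_le_one' (p.coe_le_one i) t'))
  have hset : {ω | ¬ ∃ k ≥ k₀, C ^ (t + 1) ≤ k ∧ ω ∈ doubleRun P i j t t' k} =
      {ω | ∀ k ≥ k₀, C ^ (t + 1) ≤ k → ω ∉ doubleRun P i j t t' k} := by
    ext ω; simp
  rw [ae_iff, hset, ← measureReal_eq_zero_iff]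
  refine le_antisymm (ge_of_tendsto' (tendsto_pow_atTop_nhds_zero_of_lt_one
    (sub_nonneg.2 hc1) (by linarith)) fun M => ?_) measureReal_nonneg
  obtain ⟨k, G, -, -, -, hsub, hle⟩ := exists_determinedBy_measure_le p hC i j t t' k₀ M
  exact (measureReal_mono hsub).trans hle

lemma ae_hasLongRuns (hp : ∀ i, 0 < p i) (hC : ∀ i, (P i).n ≤ C) (i j : Fin N) :
    ∀ᵐ ω ∂(bernoulliMeasure p), HasLongRuns (fun l => P (ω l)) C (P i) (P j) := by
  have h := fun t k₀ => ae_exists_doubleRun p hp hC i j t (Nat.log (P i).m ((P j).n ^ t)) k₀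
  filter_upwards [ae_all_iff.2 fun t => ae_all_iff.2 (h t)] with ω hω t k₀
  obtain ⟨k, hk0, hk, hω1, hω2⟩ := hω t k₀
  have hlt := add_lt_passage hC hk ω
  refine ⟨k, hk0, passage P k ω, hlt.le, passage_spec P k ω, ?_,
    fun l hl => congrArg P (hω1 l hl), fun l hl => congrArg P (hω2 l hl)⟩
  -- One level before passage the column scale is still below the row scale, so the overshoot is at
  -- most one radix.
  obtain ⟨s, hs⟩ := Nat.exists_eq_succ_of_ne_zero (Nat.ne_zero_of_lt hlt)
  rw [hs, scale_succ, mul_comm C]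
  exact Nat.mul_le_mul (scale_lt_of_lt_passage P (by omega)).le
    ((P (ω s)).m_lt_n.le.trans (hC _))

end Runs

/-! ### The Assouad dimension -/

lemma eq_rpow_log_div_log {a m : ℕ} (ha : 1 ≤ a) (hm : 2 ≤ m) :
    (a : ℝ) = (m : ℝ) ^ (Real.log a / Real.log m) := by
  have hm1 : (1 : ℝ) < m := by exact_mod_cast hm
  have ha0 : (0 : ℝ) < a := by exact_mod_cast ha
  rw [Real.rpow_def_of_pos (by linarith), mul_div_cancel₀ _ (Real.log_pos hm1).ne',
    Real.exp_log ha0]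

lemma le_rpow_of_log_div_log_le {a m : ℕ} (ha : 1 ≤ a) (hm : 2 ≤ m) {α : ℝ}
    (h : Real.log a / Real.log m ≤ α) : (a : ℝ) ≤ (m : ℝ) ^ α := by
  rw [eq_rpow_log_div_log ha hm]
  exact Real.rpow_le_rpow_of_exponent_le (by exact_mod_cast one_le_two.trans hm) h

lemma assouadDim_carpet_le {N : ℕ} {P : Fin N → Pattern} {ω : ℕ → Fin N} {α β : ℝ}
    (hα : ∀ l, Real.log (P (ω l)).A / Real.log (P (ω l)).m ≤ α)
    (hβ : ∀ l, Real.log (P (ω l)).B / Real.log (P (ω l)).n ≤ β) :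
    assouadDim (carpet P ω) ≤ ((α + β : ℝ) : EReal) := by
  rw [carpet_eq_digitCarpet]
  refine sInf_le ⟨_, ?_, rfl⟩
  refine assouadAdmissible_digitCarpet (C := Finset.univ.sup fun i => (P i).n)
    (fun l => Finset.le_sup (f := fun i => (P i).n) (Finset.mem_univ _))
    (le_trans (div_nonneg (Real.log_natCast_nonneg _) (Real.log_natCast_nonneg _)) (hα 0))
    (le_trans (div_nonneg (Real.log_natCast_nonneg _) (Real.log_natCast_nonneg _)) (hβ 0))
    (fun l => le_rpow_of_log_div_log_le (P (ω l)).one_le_A (P (ω l)).two_le_m (hα l))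
    (fun l => le_rpow_of_log_div_log_le (P (ω l)).one_le_B (P (ω l)).two_le_n (hβ l))

/-- Randomness enters only in the lower bound, through long runs of two letters `i` and `j`,
possibly different, that attain the two maxima. -/
theorem ae_assouadDim_carpet {N : ℕ} [NeZero N] (P : Fin N → Pattern) (p : PMF (Fin N))
    (hp : ∀ i, 0 < p i) : ∀ᵐ ω ∂(bernoulliMeasure p),
      assouadDim (carpet P ω) =
        ((Finset.univ.sup' Finset.univ_nonempty
            (fun i => Real.log (P i).A / Real.log (P i).m) +
          Finset.univ.sup' Finset.univ_nonempty
            (fun i => Real.log (P i).B / Real.log (P i).n) : ℝ) : EReal) := by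
  obtain ⟨i, -, hi⟩ := Finset.exists_mem_eq_sup' Finset.univ_nonempty
    (fun i => Real.log (P i).A / Real.log (P i).m)
  obtain ⟨j, -, hj⟩ := Finset.exists_mem_eq_sup' Finset.univ_nonempty
    (fun i => Real.log (P i).B / Real.log (P i).n)
  filter_upwards [ae_hasLongRuns p hp (C := Finset.univ.sup fun i => (P i).n)
    (fun i => Finset.le_sup (f := fun i => (P i).n) (Finset.mem_univ i)) i j] with ω hω
  refine le_antisymm (assouadDim_carpet_le
    (fun l => Finset.le_sup' (fun i => Real.log (P i).A / Real.log (P i).m) (Finset.mem_univ (ω l)))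
    (fun l => Finset.le_sup' (fun i => Real.log (P i).B / Real.log (P i).n)
      (Finset.mem_univ (ω l)))) ?_
  rw [hi, hj]
  refine le_sInf ?_
  rintro _ ⟨γ, hγ, rfl⟩
  rw [EReal.coe_le_coe_iff]
  rw [carpet_eq_digitCarpet] at hγ
  exact le_of_assouadAdmissible hω
    (div_nonneg (Real.log_natCast_nonneg _) (Real.log_natCast_nonneg _))
    (eq_rpow_log_div_log (P i).one_le_A (P i).two_le_m)
    (eq_rpow_log_div_log (P j).one_le_B (P j).two_le_n) hγ

/-- Two cells of the `2 × 3` grid, in different columns. -/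
def rowPattern : Pattern where
  m := 2
  n := 3
  two_le_m := le_rfl
  m_lt_n := by norm_num
  cells := {(0, 0), (1, 0)}
  cells_nonempty := ⟨(0, 0), by simp⟩

/-- Two cells of the `2 × 3` grid, in the same column. -/
def columnPattern : Pattern where
  m := 2
  n := 3
  two_le_m := le_rfl
  m_lt_n := by norm_num
  cells := {(0, 0), (0, 1)}
  cells_nonempty := ⟨(0, 0), by simp⟩

/-- The first pattern has exponents 1 for columns and 0 for rows, the second 0 and log 2 / log 3.
The constant sequences thus give at most 1 and log 2 / log 3, while the random carpet almost surely
has at least the sum of these; the upper bound suffices for the constant sequences. -/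
theorem exists_ae_assouadDim_const_lt :
    ∃ P : Fin 2 → Pattern, ∀ p : PMF (Fin 2), (∀ i, 0 < p i) →
      ∀ᵐ ω ∂(bernoulliMeasure p), ∀ i : Fin 2,
        assouadDim (carpet P (fun _ => i)) < assouadDim (carpet P ω) := by
  refine ⟨![rowPattern, columnPattern], fun p hp => ?_⟩
  filter_upwards [ae_assouadDim_carpet _ p hp] with ω hω i
  rw [hω]
  have hA0 : rowPattern.A = 2 := by decide
  have hB0 : rowPattern.B = 1 := by decide
  have hA1 : columnPattern.A = 1 := by decide
  have hB1 : columnPattern.B = 2 := by decide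
  have hm0 : rowPattern.m = 2 := rfl
  have hn1 : columnPattern.n = 3 := rfl
  have h2 : 0 < Real.log 2 := Real.log_pos (by norm_num)
  have h23 : Real.log 2 < Real.log 3 := Real.log_lt_log (by norm_num) (by norm_num)
  have hpos : 0 < Real.log 2 / Real.log 3 := div_pos h2 (h2.trans h23)
  have hα := Finset.le_sup' (fun i => Real.log (![rowPattern, columnPattern] i).A /
    Real.log (![rowPattern, columnPattern] i).m) (Finset.mem_univ (0 : Fin 2))
  have hβ := Finset.le_sup' (fun i => Real.log (![rowPattern, columnPattern] i).B /
    Real.log (![rowPattern, columnPattern] i).n) (Finset.mem_univ (1 : Fin 2))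
  simp only [Matrix.cons_val_zero, Matrix.cons_val_one, hA0, hB1, hm0, hn1, Nat.cast_ofNat,
    div_self h2.ne'] at hα hβ
  refine (assouadDim_carpet_le (fun _ => le_rfl) (fun _ => le_rfl)).trans_lt ?_
  rw [EReal.coe_lt_coe_iff]
  refine lt_of_lt_of_le ?_ (add_le_add hα hβ)
  fin_cases i
  · simp only [Fin.zero_eta, Matrix.cons_val_zero, hA0, hB0, hm0]
    simp [div_self h2.ne', hpos]
  · change Real.log columnPattern.A / Real.log columnPattern.m +
      Real.log columnPattern.B / Real.log columnPattern.n < _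
    rw [hA1, hB1, hn1]
    simp

end RandomCarpet

end

open RandomCarpet in
theorem theorem3p2 :
    (∀ (N : ℕ) [NeZero N] (P : Fin N → Pattern) (p : PMF (Fin N)), (∀ i, 0 < p i) →
      ∀ᵐ ω ∂(bernoulliMeasure p),
        assouadDim (carpet P ω) =
          ((Finset.univ.sup' Finset.univ_nonempty
              (fun i => Real.log (P i).A / Real.log (P i).m) +
            Finset.univ.sup' Finset.univ_nonempty
              (fun i => Real.log (P i).B / Real.log (P i).n) : ℝ) : EReal)) ∧
    (∃ P : Fin 2 → Pattern, ∀ p : PMF (Fin 2), (∀ i, 0 < p i) →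
      ∀ᵐ ω ∂(bernoulliMeasure p), ∀ i : Fin 2,
        assouadDim (carpet P (fun _ => i)) < assouadDim (carpet P ω)) :=
  ⟨fun _ _ P p hp => ae_assouadDim_carpet P p hp, exists_ae_assouadDim_const_lt⟩
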